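/- Let $S$ be a (non-empty) semitopological semigroup, i.e. a semigroup with a Hausdorff topology for which every left translation $\lambda_s(t)=st$ and every right translation $\rho_s(t)=ts$ is continuous. Let $C(S)$ be the $C^*$-algebra of bounded continuous functions $S\to\mathbb{C}$, and let $\mathcal{F}$ be an $m$-admissible subalgebra of $C(S)$: a norm-closed $*$-subalgebra containing the constants, with $L_sf=f\circ\lambda_s\in\mathcal{F}$ and $R_sf=f\circ\rho_s\in\mathcal{F}$ for all $f\in\mathcal{F}$, $s\in S$, and such that for every $\mu$ in the spectrum $\Delta$ of $\mathcal{F}$ (the non-zero multiplicative continuous linear functionals on $\mathcal{F}$) and every $f\in\mathcal{F}$ the function $T_\mu f$, $(T_\mu f)(s)=\mu(L_sf)$, lies in $\mathcal{F}$. Then $\Delta$ is a semigroup under $(\mu\nu)(f)=\mu(T_\nu f)$. Let $\tau(\mathcal{F})$ be the weak topology on $S$ generated by $\mathcal{F}$. An $\mathcal{F}$-filter on $S$ is a (proper) filter $\varphi$ on $S$ such that for every $A\in\varphi$ with $A\neq S$ there exist $B\in\varphi$ and $f\in\mathcal{F}$ with $f=0$ on $B$ and $f=1$ on $S\setminus A$;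 an $\mathcal{F}$-ultrafilter is an $\mathcal{F}$-filter that is maximal with respect to inclusion. Let $\delta S$ be the set of all $\mathcal{F}$-ultrafilters on $S$, put $\widehat{A}=\{p\in\delta S : A\in p\}$ for $A\subseteq S$, and give $\delta S$ the topology with base $\{\widehat{A}: A\subseteq S\}$. The map $\Delta\to\delta S$ sending $\mu$ to the filter generated by the sets $\{s\in S: |f(s)|\le r\}$, $f\in\ker\mu$, $r>0$, is a bijection, and $\delta S$ carries the semigroup operation transported from $\Delta$ along it. Let $K$ be the smallest (two-sided) ideal of $\delta S$. For $s\in S$ and $A\subseteq S$ put $s^{-1}A=\{t\in S: st\in A\}$. A set $A\subseteq S$ is piecewise syndetic if there is a finite set $E\subseteq S$ such that the family $\{s^{-1}(\bigcup_{t\in E}t^{-1}A): s\in S\}$ has the finite intersection property. Theorem. The following statements hold for every subset $A$ of $S$: (i) If $\widehat{A}\cap K\neq\emptyset$, then $A$ is piecewise syndetic. (ii) If $A$ is $\tau(\mathcal{F})$-open and piecewise syndetic, then $\mathrm{cl}_{\delta S}(\widehat{A})\cap K\neq\emptyset$. -/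

import Mathlib

open Set Filter Topology BoundedContinuousFunction

noncomputable section

namespace SemigroupCompactification

universe u

variable {S : Type u} [Semigroup S] [TopologicalSpace S] [SeparatelyContinuousMul S]

/-- The left translate `L_s f = f ∘ λ_s`, i.e. `t ↦ f (s * t)`. -/
def leftTranslate (s : S) (f : S →ᵇ ℂ) : S →ᵇ ℂ :=
  f.compContinuous ⟨fun t => s * t, continuous_const_mul s⟩

/-- The right translate `R_s f = f ∘ ρ_s`, i.e. `t ↦ f (t * s)`. -/
def rightTranslate (s : S) (f : S →ᵇ ℂ) : S →ᵇ ℂ :=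
  f.compContinuous ⟨fun t => t * s, continuous_mul_const s⟩

@[simp] lemma leftTranslate_apply (s t : S) (f : S →ᵇ ℂ) : leftTranslate s f t = f (s * t) := rfl

@[simp] lemma rightTranslate_apply (s t : S) (f : S →ᵇ ℂ) : rightTranslate s f t = f (t * s) := rfl

variable (S) in
/-- An `m`-admissible subalgebra of the C⋆-algebra of bounded continuous complex functions on `S`:
a (norm-closed, unital) C⋆-subalgebra `F`, translation invariant, such that for every `μ` in the
spectrum of `F` and every `f ∈ F` the function `T_μ f : s ↦ μ (L_s f)` belongs to `F`. -/
structure MAdmissible extends StarSubalgebra ℂ (S →ᵇ ℂ) where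
  isClosed' : IsClosed (toStarSubalgebra : Set (S →ᵇ ℂ))
  left_mem : ∀ (s : S), ∀ f ∈ toStarSubalgebra, leftTranslate s f ∈ toStarSubalgebra
  right_mem : ∀ (s : S), ∀ f ∈ toStarSubalgebra, rightTranslate s f ∈ toStarSubalgebra
  introverted : ∀ (μ : WeakDual.characterSpace ℂ toStarSubalgebra) (f : toStarSubalgebra),
    ∃ g ∈ toStarSubalgebra, ∀ s : S, g s = μ ⟨leftTranslate s f, left_mem s f f.2⟩

namespace MAdmissible

variable (F : MAdmissible S)

/-- The algebra `F` as a type. -/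
abbrev Alg : Type u := F.toStarSubalgebra

/-- The spectrum `Δ` of `F`: the nonzero multiplicative continuous linear functionals on `F`. -/
abbrev Spectrum : Type u := WeakDual.characterSpace ℂ F.Alg

instance : IsClosed (F.toStarSubalgebra : Set (S →ᵇ ℂ)) := F.isClosed'

instance : CompleteSpace F.Alg := F.isClosed'.completeSpace_coe

variable {F}

/-- The value of an element of `F` at a point of `S`. -/
def ev (f : F.Alg) (s : S) : ℂ := (f : S →ᵇ ℂ) s

/-- `L_s` as a map `F → F`. -/
def L (s : S) (f : F.Alg) : F.Alg := ⟨leftTranslate s f, F.left_mem s f f.2⟩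

@[ext] lemma alg_ext {f g : F.Alg} (h : ∀ s, ev f s = ev g s) : f = g :=
  Subtype.ext (BoundedContinuousFunction.ext h)

@[simp] lemma ev_add (f g : F.Alg) (s : S) : ev (f + g) s = ev f s + ev g s := rfl
@[simp] lemma ev_sub (f g : F.Alg) (s : S) : ev (f - g) s = ev f s - ev g s := rfl
@[simp] lemma ev_mul (f g : F.Alg) (s : S) : ev (f * g) s = ev f s * ev g s := rfl
@[simp] lemma ev_one (s : S) : ev (1 : F.Alg) s = 1 := rfl
@[simp] lemma ev_zero (s : S) : ev (0 : F.Alg) s = 0 := rfl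
@[simp] lemma ev_star (f : F.Alg) (s : S) : ev (star f) s = star (ev f s) := rfl
@[simp] lemma ev_smul (c : ℂ) (f : F.Alg) (s : S) : ev (c • f) s = c * ev f s := rfl
@[simp] lemma ev_algebraMap (c : ℂ) (s : S) : ev (algebraMap ℂ F.Alg c) s = c := by
  rw [Algebra.algebraMap_eq_smul_one]; simp
@[simp] lemma ev_L (s t : S) (f : F.Alg) : ev (L s f) t = ev f (s * t) := rfl

/-- The left introversion operator `T_μ : F → F`, `(T_μ f)(s) = μ (L_s f)`. -/
def T (μ : F.Spectrum) (f : F.Alg) : F.Alg :=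
  ⟨(F.introverted μ f).choose, (F.introverted μ f).choose_spec.1⟩

@[simp] lemma ev_T (μ : F.Spectrum) (f : F.Alg) (s : S) : ev (T μ f) s = μ (L s f) :=
  (F.introverted μ f).choose_spec.2 s

/-- `T_μ` is an algebra homomorphism. -/
def THom (μ : F.Spectrum) : F.Alg →ₐ[ℂ] F.Alg where
  toFun := T μ
  map_one' := by
    ext s
    have : L s (1 : F.Alg) = 1 := by ext; simp
    simp [this]
  map_mul' f g := by
    ext s
    have : L s (f * g) = L s f * L s g := by ext; simp
    simp [this]
  map_zero' := by
    ext s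
    have : L s (0 : F.Alg) = 0 := by ext; simp
    simp [this]
  map_add' f g := by
    ext s
    have : L s (f + g) = L s f + L s g := by ext; simp
    simp [this]
  commutes' c := by
    ext s
    have : L s (algebraMap ℂ F.Alg c) = algebraMap ℂ F.Alg c := by ext; simp
    simp [this, AlgHomClass.commutes]

/-- The semigroup operation of the spectrum: `(μ ν)(f) = μ (T_ν f)`. -/
instance : Mul F.Spectrum where
  mul μ ν := WeakDual.CharacterSpace.equivAlgHom.symm
    ((WeakDual.CharacterSpace.equivAlgHom μ).comp (THom ν))

@[simp] lemma spectrum_mul_apply (μ ν : F.Spectrum) (f : F.Alg) : (μ * ν) f = μ (T ν f) := rfl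

instance : Semigroup F.Spectrum where
  mul_assoc μ ν π := by
    ext f
    simp only [spectrum_mul_apply]
    congr 1
    ext s
    simp only [ev_T, spectrum_mul_apply]
    congr 1
    ext t
    simp only [ev_T, ev_L]
    congr 1
    ext r
    simp [mul_assoc]

variable (F)

/-- The weak topology `τ(F)` on `S` generated by `F`. -/
abbrev tau : TopologicalSpace S :=
  ⨅ f : F.Alg, TopologicalSpace.induced (ev f) inferInstance

/-- An `F`-filter on `S`: a (proper) filter `φ` such that for every `A ∈ φ` with `A ≠ S` there are
`B ∈ φ` and `f ∈ F` with `f = 0` on `B` and `f = 1` off `A`. -/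
def IsFFilter (φ : Filter S) : Prop :=
  φ.NeBot ∧ ∀ A ∈ φ, A ≠ univ →
    ∃ B ∈ φ, ∃ f : F.Alg, (∀ s ∈ B, ev f s = 0) ∧ (∀ s ∉ A, ev f s = 1)

/-- An `F`-ultrafilter: an `F`-filter that is maximal for inclusion of the families of sets
(for the order `≤` on `Filter S`, which is reverse inclusion, this reads as minimality). -/
def IsFUltrafilter (φ : Filter S) : Prop :=
  F.IsFFilter φ ∧ ∀ ψ : Filter S, F.IsFFilter ψ → (∀ A ∈ φ, A ∈ ψ) → ψ = φ

/-- The space `δS` of all `F`-ultrafilters on `S`. -/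
def Delta : Type u := {p : Filter S // F.IsFUltrafilter p}

variable {F}

/-- `Â = {p ∈ δS : A ∈ p}`. -/
def hat (A : Set S) : Set F.Delta := {p | A ∈ p.1}

/-- The topology of `δS`, with base the sets `Â`, `A ⊆ S`. -/
instance : TopologicalSpace F.Delta :=
  TopologicalSpace.generateFrom {U | ∃ A : Set S, U = hat A}

/-- `S(f, r) = {s ∈ S : |f s| ≤ r}`. -/
def sublevel (f : F.Alg) (r : ℝ) : Set S := {s | ‖ev f s‖ ≤ r}

lemma sublevel_inter (μ : F.Spectrum) {f g : F.Alg} (hf : μ f = 0) (hg : μ g = 0) {r r' : ℝ}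
    (hr : 0 < r) (hr' : 0 < r') :
    ∃ h : F.Alg, μ h = 0 ∧ ∃ q > 0, sublevel h q ⊆ sublevel f r ∩ sublevel g r' := by
  refine ⟨star f * f + star g * g, by simp [hf, hg], (min r r') ^ 2, by positivity, ?_⟩
  intro s hs
  have e : ev (star f * f + star g * g) s = ((‖ev f s‖ ^ 2 + ‖ev g s‖ ^ 2 : ℝ) : ℂ) := by
    simp [Complex.conj_mul']
  have h0 : 0 ≤ ‖ev f s‖ ^ 2 + ‖ev g s‖ ^ 2 := by positivity
  have hs' : ‖ev f s‖ ^ 2 + ‖ev g s‖ ^ 2 ≤ (min r r') ^ 2 := by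
    have := hs
    simp only [sublevel, mem_ofPred_eq, e, Complex.norm_real, Real.norm_of_nonneg h0] at this
    exact this
  have hm : 0 ≤ min r r' := by positivity
  constructor
  · exact (abs_le_of_sq_le_sq' (by nlinarith [sq_nonneg ‖ev g s‖]) hm).2.trans (min_le_left _ _)
  · exact (abs_le_of_sq_le_sq' (by nlinarith [sq_nonneg ‖ev f s‖]) hm).2.trans (min_le_right _ _)

/-- The filter `p(μ)` on `S` generated by the filter base `{S(f, r) : f ∈ ker μ, r > 0}`. -/
def pFilter (μ : F.Spectrum) : Filter S where
  sets := {A | ∃ f : F.Alg, μ f = 0 ∧ ∃ r > 0, sublevel f r ⊆ A}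
  univ_sets := ⟨0, map_zero μ, 1, one_pos, subset_univ _⟩
  sets_of_superset := by
    rintro A B ⟨f, hf, r, hr, h⟩ hAB
    exact ⟨f, hf, r, hr, h.trans hAB⟩
  inter_sets := by
    rintro A B ⟨f, hf, r, hr, h⟩ ⟨g, hg, r', hr', h'⟩
    obtain ⟨k, hk, q, hq, hkq⟩ := sublevel_inter μ hf hg hr hr'
    exact ⟨k, hk, q, hq, hkq.trans (inter_subset_inter h h')⟩

lemma mem_pFilter {μ : F.Spectrum} {A : Set S} :
    A ∈ pFilter μ ↔ ∃ f : F.Alg, μ f = 0 ∧ ∃ r > 0, sublevel f r ⊆ A := Iff.rfl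

lemma sublevel_nonempty {μ : F.Spectrum} {f : F.Alg} (hf : μ f = 0) {r : ℝ} (hr : 0 < r) :
    (sublevel f r).Nonempty := by
  by_contra hne
  have hlt : ∀ s, r < ‖ev f s‖ := fun s => by
    by_contra h
    exact hne ⟨s, not_lt.1 h⟩
  have hz : ∀ s, ev f s ≠ 0 := fun s => norm_pos_iff.1 (hr.trans (hlt s))
  let g : S →ᵇ ℂ := BoundedContinuousFunction.ofNormedAddCommGroup (fun s => (ev f s)⁻¹)
    ((f : S →ᵇ ℂ).continuous.inv₀ hz) r⁻¹ (fun s => by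
      rw [norm_inv]; exact inv_anti₀ hr (hlt s).le)
  have hu : IsUnit (f : S →ᵇ ℂ) := by
    refine IsUnit.of_mul_eq_one g ?_
    ext s
    exact mul_inv_cancel₀ (hz s)
  have hu' : IsUnit f := (StarSubalgebra.coe_isUnit (S := F.toStarSubalgebra)).1 hu
  have := hu'.map μ
  rw [hf] at this
  exact not_isUnit_zero this

lemma pFilter_neBot (μ : F.Spectrum) : (pFilter μ).NeBot := by
  rw [← forall_mem_nonempty_iff_neBot]
  rintro A ⟨f, hf, r, hr, h⟩
  exact (sublevel_nonempty hf hr).mono h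

/-- Composition of an element of `F` with a continuous function on `ℂ` stays in `F`. -/
lemma exists_comp (f : F.Alg) (φ : ℂ → ℂ) (hφ : Continuous φ) :
    ∃ g : F.Alg, ∀ s, ev g s = φ (ev f s) := by
  have hn : IsStarNormal (f : S →ᵇ ℂ) := ⟨mul_comm _ _⟩
  refine ⟨⟨cfc φ (f : S →ᵇ ℂ), cfc_mem (𝕜 := ℂ) φ f.2⟩, fun s => ?_⟩
  let e : (S →ᵇ ℂ) →⋆ₐ[ℂ] ℂ :=
    { toFun := fun h => h s
      map_one' := rfl
      map_mul' := fun _ _ => rfl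
      map_zero' := rfl
      map_add' := fun _ _ => rfl
      commutes' := fun _ => rfl
      map_star' := fun _ => rfl }
  have he : Continuous e := continuous_eval_const s
  have h1 : e (cfc φ (f : S →ᵇ ℂ)) = cfc φ (e f) :=
    StarAlgHomClass.map_cfc (R := ℂ) (S := ℂ) e φ _ hφ.continuousOn he hn
      (hφa := ⟨mul_comm _ _⟩)
  have h2 : cfc φ (e f) = φ (e f) := cfc_algebraMap (A := ℂ) (e f) φ
  exact h1.trans h2

lemma pFilter_isFFilter (μ : F.Spectrum) : F.IsFFilter (pFilter μ) := by
  refine ⟨pFilter_neBot μ, ?_⟩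
  rintro A ⟨f, hf, r, hr, h⟩ -
  obtain ⟨g, hg⟩ := exists_comp f (fun z => ((max 0 (min 1 (2 * ‖z‖ / r - 1)) : ℝ) : ℂ))
    (by fun_prop)
  refine ⟨sublevel f (r / 2), ⟨f, hf, r / 2, by positivity, subset_rfl⟩, g, ?_, ?_⟩
  · intro s hs
    have hs' : ‖ev f s‖ ≤ r / 2 := hs
    have : 2 * ‖ev f s‖ / r - 1 ≤ 0 := by
      rw [sub_nonpos, div_le_one hr]; linarith
    rw [hg, max_eq_left (min_le_of_right_le this), Complex.ofReal_zero]
  · intro s hs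
    have hs' : r < ‖ev f s‖ := by
      by_contra hh
      exact hs (h (not_lt.1 hh))
    have : 1 ≤ 2 * ‖ev f s‖ / r - 1 := by
      rw [le_sub_iff_add_le, le_div_iff₀ hr]; linarith
    rw [hg, min_eq_left this, max_eq_right zero_le_one, Complex.ofReal_one]

lemma sub_value_mem_ker (μ : F.Spectrum) (f : F.Alg) : μ (f - algebraMap ℂ F.Alg (μ f)) = 0 := by
  simp [AlgHomClass.commutes]

lemma sublevel_mem_pFilter (μ : F.Spectrum) (f : F.Alg) {r : ℝ} (hr : 0 < r) :
    {s | ‖ev f s - μ f‖ ≤ r} ∈ pFilter μ :=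
  ⟨_, sub_value_mem_ker μ f, r, hr, fun s hs => by simpa [sublevel] using hs⟩

lemma pFilter_isFUltrafilter (μ : F.Spectrum) : F.IsFUltrafilter (pFilter μ) := by
  refine ⟨pFilter_isFFilter μ, fun ψ hψ hsub => ?_⟩
  have := hψ.1
  ext A
  refine ⟨fun hA => ?_, hsub A⟩
  by_cases hAu : A = univ
  · rw [hAu]; exact univ_mem
  obtain ⟨B, hB, f, hf0, hf1⟩ := hψ.2 A hA hAu
  have hμ : μ f = 0 := by
    by_contra hne
    have hpos : 0 < ‖μ f‖ / 2 := by positivity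
    obtain ⟨s, hsB, hs⟩ := ψ.nonempty_of_mem
      (inter_mem hB (hsub _ (sublevel_mem_pFilter μ f hpos)))
    have hs' : ‖ev f s - μ f‖ ≤ ‖μ f‖ / 2 := hs
    rw [hf0 s hsB, zero_sub, norm_neg] at hs'
    linarith
  refine ⟨f, hμ, 1 / 2, by norm_num, fun s hs => ?_⟩
  by_contra hsA
  have hs' : ‖ev f s‖ ≤ 1 / 2 := hs
  rw [hf1 s hsA, norm_one] at hs'
  norm_num at hs'

/-- The mapping `μ ↦ p(μ)` from the spectrum to `δS`. -/
def toDelta (μ : F.Spectrum) : F.Delta := ⟨pFilter μ, pFilter_isFUltrafilter μ⟩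

lemma toDelta_injective : Function.Injective (toDelta (F := F)) := by
  intro μ ν h
  have h' : pFilter μ = pFilter ν := congrArg Subtype.val h
  have := pFilter_neBot μ
  ext f
  by_contra hne
  have hpos : 0 < ‖μ f - ν f‖ / 3 := by
    have := norm_pos_iff.2 (sub_ne_zero.2 hne)
    positivity
  obtain ⟨s, h1, h2⟩ := (pFilter μ).nonempty_of_mem
    (inter_mem (sublevel_mem_pFilter μ f hpos) (h' ▸ sublevel_mem_pFilter ν f hpos))
  have h1' : ‖ev f s - μ f‖ ≤ ‖μ f - ν f‖ / 3 := h1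
  have h2' : ‖ev f s - ν f‖ ≤ ‖μ f - ν f‖ / 3 := h2
  have : ‖μ f - ν f‖ ≤ ‖ev f s - μ f‖ + ‖ev f s - ν f‖ := by
    rw [norm_sub_rev (ev f s) (μ f)]
    calc _ = ‖(μ f - ev f s) + (ev f s - ν f)‖ := by ring_nf
      _ ≤ _ := norm_add_le _ _
  linarith

lemma exists_ultrafilter_lim (U : Ultrafilter S) (f : F.Alg) :
    ∃ c : ℂ, Tendsto (ev f) U (𝓝 c) := by
  have hK : IsCompact (Metric.closedBall (0 : ℂ) ‖(f : S →ᵇ ℂ)‖) := isCompact_closedBall _ _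
  obtain ⟨c, -, hc⟩ := hK.ultrafilter_le_nhds (U.map (ev f)) (by
    rw [le_principal_iff]
    change ev f ⁻¹' _ ∈ (U : Filter S)
    exact Filter.univ_mem' fun s => by
      simpa [ev] using (f : S →ᵇ ℂ).norm_coe_le_norm s)
  exact ⟨c, hc⟩

lemma toDelta_surjective : Function.Surjective (toDelta (F := F)) := by
  rintro ⟨p, hp⟩
  have := hp.1.1
  obtain ⟨U, hU⟩ := p.exists_ultrafilter_le
  choose l hl using exists_ultrafilter_lim (F := F) U
  let a : F.Alg →ₐ[ℂ] ℂ :=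
    { toFun := l
      map_one' := tendsto_nhds_unique (hl 1) tendsto_const_nhds
      map_mul' := fun f g => tendsto_nhds_unique (hl (f * g)) ((hl f).mul (hl g))
      map_zero' := tendsto_nhds_unique (hl 0) tendsto_const_nhds
      map_add' := fun f g => tendsto_nhds_unique (hl (f + g)) ((hl f).add (hl g))
      commutes' := fun c => tendsto_nhds_unique (hl _) (by
        have : ev (algebraMap ℂ F.Alg c) = fun _ => c := by ext; simp
        rw [this]; exact tendsto_const_nhds) }
  let μ : F.Spectrum := WeakDual.CharacterSpace.equivAlgHom.symm a
  refine ⟨μ, Subtype.ext (hp.2 _ (pFilter_isFFilter μ) fun A hA => ?_)⟩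
  by_cases hAu : A = univ
  · rw [hAu]; exact univ_mem
  obtain ⟨B, hB, f, hf0, hf1⟩ := hp.1.2 A hA hAu
  have hμ : μ f = 0 := tendsto_nhds_unique (hl f)
    (tendsto_const_nhds.congr' (by filter_upwards [hU hB] with s hs using (hf0 s hs).symm))
  refine ⟨f, hμ, 1 / 2, by norm_num, fun s hs => ?_⟩
  by_contra hsA
  have hs' : ‖ev f s‖ ≤ 1 / 2 := hs
  rw [hf1 s hsA, norm_one] at hs'
  norm_num at hs'

/-- The bijection `μ ↦ p(μ)` between the spectrum and `δS`. -/
def equivDelta : F.Spectrum ≃ F.Delta :=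
  Equiv.ofBijective toDelta ⟨toDelta_injective, toDelta_surjective⟩

/-- The semigroup operation of `δS`, transported from the spectrum along `μ ↦ p(μ)`. -/
instance : Semigroup F.Delta where
  mul p q := equivDelta (equivDelta.symm p * equivDelta.symm q)
  mul_assoc p q r := by
    change equivDelta (equivDelta.symm (equivDelta _) * _) =
      equivDelta (_ * equivDelta.symm (equivDelta _))
    simp [mul_assoc]

lemma toDelta_mul (μ ν : F.Spectrum) : toDelta (μ * ν) = toDelta μ * toDelta ν := by
  change equivDelta _ = equivDelta (equivDelta.symm (equivDelta μ) * equivDelta.symm (equivDelta ν))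
  simp

end MAdmissible

/-- A (two-sided) ideal of a semigroup: a non-empty `I` with `X I ⊆ I` and `I X ⊆ I`. -/
def IsIdeal {X : Type*} [Semigroup X] (I : Set X) : Prop :=
  I.Nonempty ∧ ∀ x : X, ∀ y ∈ I, x * y ∈ I ∧ y * x ∈ I

/-- The smallest ideal of a semigroup (the intersection of all its ideals). -/
def smallestIdeal (X : Type*) [Semigroup X] : Set X := ⋂₀ {I | IsIdeal I}

/-- `s⁻¹A = {t : s * t ∈ A}`. -/
def leftQuotient {X : Type*} [Semigroup X] (s : X) (A : Set X) : Set X := {t | s * t ∈ A}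

/-- `A` is piecewise syndetic: for some finite `E ⊆ X`, the family
`{s⁻¹(⋃ t ∈ E, t⁻¹A) : s ∈ X}` has the finite intersection property. -/
def IsPiecewiseSyndetic {X : Type*} [Semigroup X] (A : Set X) : Prop :=
  ∃ E : Finset X, ∀ G : Finset X,
    (⋂ s ∈ G, leftQuotient s (⋃ t ∈ E, leftQuotient t A)).Nonempty

end SemigroupCompactification

end

noncomputable section

namespace SemigroupCompactification

/-! ### Smallest ideals of compact right topological semigroups. -/

section SmallestIdeal

variable {X : Type*} [Semigroup X]

/-! The work takes place in the spectrum, a compact Hausdorff semigroup with continuous right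
multiplications, in which the evaluations `evalChar F s` are dense and multiply continuously from
the left. For (i), `A ∈ pFilter μ` gives an open `U` around `μ` all of whose evaluations come from
`A`. As `μ` lies in the smallest ideal, every `ν * μ` can be multiplied back to `μ`, and by density
into `U` by an evaluation; compactness leaves finitely many of these, which form `E`
(`isPiecewiseSyndetic_of_mem_hat`). For (ii), the finite intersection property yields an
ultrafilter, and for its limit `μ` every `ν * μ` is moved by some `t ∈ E` into the closure of the
evaluations at `A`. Taking `ν` in the smallest ideal gives the required point
(`exists_mem_closure_of_isPiecewiseSyndetic`), which `continuous_toDelta` carries to `δS`. -/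

lemma mul_left_mem_smallestIdeal (x : X) {y : X} (hy : y ∈ smallestIdeal X) :
    x * y ∈ smallestIdeal X :=
  fun I hI => (hI.2 x y (hy I hI)).1

lemma mul_right_mem_smallestIdeal {y : X} (hy : y ∈ smallestIdeal X) (x : X) :
    y * x ∈ smallestIdeal X :=
  fun I hI => (hI.2 x y (hy I hI)).2

lemma map_mem_smallestIdeal {Y : Type*} [Semigroup Y] (e : X ≃* Y) {x : X}
    (hx : x ∈ smallestIdeal X) : e x ∈ smallestIdeal Y := by
  rintro I ⟨⟨y, hy⟩, hI⟩
  refine hx (e ⁻¹' I) ⟨⟨e.symm y, by simpa using hy⟩, fun a b hb => ?_⟩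
  simpa using hI (e a) (e b) hb

/-- A compact right topological semigroup has a minimal closed left ideal, each of whose elements
generates it as a left ideal. -/
lemma exists_minimal_left_ideal [Nonempty X] [TopologicalSpace X] [CompactSpace X] [T2Space X]
    (hX : ∀ r : X, Continuous (· * r)) :
    ∃ L : Set X, L.Nonempty ∧ (∀ x : X, ∀ y ∈ L, x * y ∈ L) ∧
      ∀ x ∈ L, ∀ y ∈ L, ∃ w : X, w * y = x := by
  obtain ⟨L, hL⟩ := zorn_superset
      {L : Set X | IsClosed L ∧ L.Nonempty ∧ ∀ x : X, ∀ y ∈ L, x * y ∈ L} (by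
    intro c hcs hc
    refine ⟨⋂₀ c, ⟨isClosed_sInter fun t ht => (hcs ht).1, ?_, fun x y hy t ht =>
      (hcs ht).2.2 x y (hy t ht)⟩, fun s hs => sInter_subset_of_mem hs⟩
    obtain rfl | hne := c.eq_empty_or_nonempty
    · rw [sInter_empty]; exact univ_nonempty
    · have : Nonempty c := hne.to_subtype
      rw [sInter_eq_iInter]
      exact IsCompact.nonempty_iInter_of_directed_nonempty_isCompact_isClosed _
        (DirectedOn.directed_val (IsChain.directedOn hc.symm))
        (fun i => (hcs i.2).2.1) (fun i => (hcs i.2).1.isCompact) fun i => (hcs i.2).1)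
  refine ⟨L, hL.prop.2.1, hL.prop.2.2, fun x hx y hy => ?_⟩
  -- `X y` is a compact, hence closed, left ideal inside `L`, so minimality forces `X y = L`.
  have h : range (· * y) ∈
      {L : Set X | IsClosed L ∧ L.Nonempty ∧ ∀ x : X, ∀ y ∈ L, x * y ∈ L} := by
    refine ⟨(isCompact_range (hX y)).isClosed, range_nonempty _, ?_⟩
    rintro a _ ⟨b, rfl⟩
    exact ⟨a * b, mul_assoc _ _ _⟩
  have hsub : range (· * y) ⊆ L := by
    rintro _ ⟨b, rfl⟩
    exact hL.prop.2.2 b y hy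
  exact hL.le_of_le h hsub hx

variable [Nonempty X] [TopologicalSpace X] [CompactSpace X] [T2Space X]

lemma smallestIdeal_nonempty (hX : ∀ r : X, Continuous (· * r)) :
    (smallestIdeal X).Nonempty := by
  obtain ⟨L, ⟨x, hx⟩, hL, hmin⟩ := exists_minimal_left_ideal hX
  refine ⟨x, ?_⟩
  rintro I ⟨⟨y, hy⟩, hI⟩
  obtain ⟨w, hw⟩ := hmin x hx (y * x) (hL y x hx)
  exact hw ▸ (hI w _ (hI x y hy).2).1

/-- The elements with this property form a two-sided ideal, non-empty because it contains a minimal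
left ideal. -/
lemma exists_mul_mul_eq_of_mem_smallestIdeal (hX : ∀ r : X, Continuous (· * r)) {x : X}
    (hx : x ∈ smallestIdeal X) (z : X) : ∃ w, w * (z * x) = x := by
  refine hx {x | ∀ z, ∃ w, w * (z * x) = x} ⟨?_, fun a b hb => ⟨fun z => ?_, fun z => ?_⟩⟩ z
  · obtain ⟨L, ⟨x, hx⟩, hL, hmin⟩ := exists_minimal_left_ideal hX
    exact ⟨x, fun z => hmin x hx _ (hL z x hx)⟩
  · obtain ⟨w, hw⟩ := hb (z * a)
    refine ⟨a * w, ?_⟩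
    rw [mul_assoc, ← mul_assoc z, hw]
  · obtain ⟨w, hw⟩ := hb z
    refine ⟨w, ?_⟩
    rw [← mul_assoc z, ← mul_assoc w, hw]

end SmallestIdeal

namespace MAdmissible

universe u

variable {S : Type u} [Semigroup S] [TopologicalSpace S] [SeparatelyContinuousMul S]
  {F : MAdmissible S}

/-! ### Topology of the spectrum and density of the evaluations. -/

lemma continuous_spectrum_iff {Y : Type*} [TopologicalSpace Y] {g : Y → F.Spectrum} :
    Continuous g ↔ ∀ f : F.Alg, Continuous fun y => g y f :=
  ⟨fun h f => (WeakDual.eval_continuous f).comp (continuous_subtype_val.comp h),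
    fun h => (WeakDual.continuous_of_continuous_eval h).subtype_mk _⟩

lemma continuous_spectrum_eval (f : F.Alg) : Continuous fun μ : F.Spectrum => μ f :=
  continuous_spectrum_iff.1 continuous_id f

lemma continuous_spectrum_mul_right (ν : F.Spectrum) : Continuous (· * ν) :=
  continuous_spectrum_iff.2 fun f => continuous_spectrum_eval (T ν f)

variable (F) in
/-- Evaluation at a point of `S`, as an element of the spectrum. -/
def evalChar (s : S) : F.Spectrum :=
  WeakDual.CharacterSpace.equivAlgHom.symm
    { toFun := fun f => ev f s
      map_one' := rfl
      map_mul' := fun _ _ => rfl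
      map_zero' := rfl
      map_add' := fun _ _ => rfl
      commutes' := fun c => ev_algebraMap c s }

@[simp] lemma evalChar_apply (s : S) (f : F.Alg) : evalChar F s f = ev f s := rfl

lemma evalChar_mul_apply (s : S) (ν : F.Spectrum) (f : F.Alg) :
    (evalChar F s * ν) f = ν (L s f) := by simp

lemma evalChar_mul (s t : S) : evalChar F (s * t) = evalChar F s * evalChar F t := by
  ext f
  simp

lemma continuous_evalChar_mul (s : S) : Continuous fun ν : F.Spectrum => evalChar F s * ν :=
  continuous_spectrum_iff.2 fun f => by
    simpa only [evalChar_mul_apply] using continuous_spectrum_eval (L s f)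

lemma tendsto_ev_pFilter (μ : F.Spectrum) (f : F.Alg) :
    Tendsto (ev f) (pFilter μ) (𝓝 (μ f)) := by
  rw [Metric.nhds_basis_closedBall.tendsto_right_iff]
  intro r hr
  filter_upwards [sublevel_mem_pFilter μ f hr] with s hs
  simpa [dist_eq_norm] using hs

lemma tendsto_evalChar_pFilter (μ : F.Spectrum) :
    Tendsto (evalChar F) (pFilter μ) (𝓝 μ) := by
  rw [tendsto_subtype_rng]
  refine (WeakBilin.tendsto_iff_forall_eval_tendsto _ ContinuousLinearMap.coe_injective).2
    fun f => tendsto_ev_pFilter μ f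

lemma denseRange_evalChar : DenseRange (evalChar F) := fun μ =>
  have := pFilter_neBot μ
  mem_closure_of_tendsto (tendsto_evalChar_pFilter μ) (Eventually.of_forall mem_range_self)

/-! ### Transfer from the spectrum to `δS`. -/

lemma continuous_toDelta : Continuous (toDelta (F := F)) := by
  refine continuous_generateFrom_iff.2 ?_
  rintro _ ⟨B, rfl⟩
  refine isOpen_iff_mem_nhds.2 ?_
  rintro μ ⟨f, hf, r, hr, h⟩
  have : ∀ᶠ ν : F.Spectrum in 𝓝 μ, ‖ν f‖ < r / 2 :=
    (continuous_spectrum_eval f).norm.continuousAt.eventually_lt continuousAt_const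
      (by simpa [hf] using hr)
  filter_upwards [this] with ν hν
  -- Where `f` is within `r / 2` of `ν f`, its modulus is at most `r`.
  refine mem_of_superset (sublevel_mem_pFilter ν f (half_pos hr)) fun s hs => h ?_
  have hs' : ‖ev f s - ν f‖ ≤ r / 2 := hs
  have := norm_le_norm_add_norm_sub' (ev f s) (ν f)
  change ‖ev f s‖ ≤ r
  linarith

/-- The filter of the evaluation at `a` is finer than the `τ(F)`-neighbourhood filter of `a`. -/
lemma toDelta_evalChar_mem_hat {A : Set S} (hA : IsOpen[F.tau] A) {a : S} (ha : a ∈ A) :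
    toDelta (evalChar F a) ∈ hat A := by
  have h : A ∈ @nhds S F.tau a := @IsOpen.mem_nhds S F.tau a A hA ha
  rw [nhds_iInf] at h
  refine (le_iInf fun f => ?_ : pFilter (evalChar F a) ≤ _) h
  rw [nhds_induced, ← map_le_iff_le_comap]
  exact tendsto_ev_pFilter _ f

variable (F) in
/-- The bijection between the spectrum and `δS` as an isomorphism of semigroups. -/
def mulEquivDelta : F.Spectrum ≃* F.Delta :=
  { equivDelta with map_mul' := toDelta_mul }

lemma toDelta_mem_smallestIdeal {μ : F.Spectrum} (h : μ ∈ smallestIdeal F.Spectrum) :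
    toDelta μ ∈ smallestIdeal F.Delta :=
  map_mem_smallestIdeal (mulEquivDelta F) h

lemma mem_smallestIdeal_of_toDelta {μ : F.Spectrum} (h : toDelta μ ∈ smallestIdeal F.Delta) :
    μ ∈ smallestIdeal F.Spectrum := by
  have := map_mem_smallestIdeal (mulEquivDelta F).symm h
  rwa [show toDelta μ = mulEquivDelta F μ from rfl, MulEquiv.symm_apply_apply] at this

/-! ### The two implications, stated in the spectrum. -/

variable [Nonempty S]

instance : Nonempty F.Spectrum := ‹Nonempty S›.map (evalChar F)

lemma isPiecewiseSyndetic_of_mem_hat {A : Set S} {μ : F.Spectrum} (hA : A ∈ pFilter μ)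
    (hμ : μ ∈ smallestIdeal F.Spectrum) : IsPiecewiseSyndetic A := by
  classical
  obtain ⟨f, hf, r, hr, h⟩ := hA
  let U : Set F.Spectrum := {ν | ‖ν f‖ < r}
  have hU : IsOpen U := isOpen_lt (continuous_spectrum_eval f).norm continuous_const
  have hμU : μ ∈ U := by simpa [U, hf] using hr
  have hUA : ∀ s, evalChar F s ∈ U → s ∈ A := fun s hs => h (show ‖ev f s‖ ≤ r from le_of_lt hs)
  have hcov : ∀ ν : F.Spectrum, ∃ t : S, evalChar F t * (ν * μ) ∈ U := fun ν => by
    obtain ⟨w, hw⟩ := exists_mul_mul_eq_of_mem_smallestIdeal continuous_spectrum_mul_right hμ ν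
    exact denseRange_evalChar.exists_mem_open
      (hU.preimage (continuous_spectrum_mul_right (ν * μ))) ⟨w, by simpa [hw] using hμU⟩
  obtain ⟨E, hE⟩ := isCompact_univ.elim_finite_subcover
    (fun t : S => {ν : F.Spectrum | evalChar F t * (ν * μ) ∈ U})
    (fun t => hU.preimage ((continuous_evalChar_mul t).comp (continuous_spectrum_mul_right μ)))
    (fun ν _ => mem_iUnion.2 (hcov ν))
  refine ⟨E, fun G => ?_⟩
  -- For a finite `G` the condition is open and holds at `μ`, so by density it holds at some
  -- evaluation.
  let V : Set F.Spectrum := ⋂ s ∈ G, ⋃ t ∈ E, {ν | evalChar F t * (evalChar F s * ν) ∈ U}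
  have hV : IsOpen V := isOpen_biInter_finset fun s _ => isOpen_biUnion fun t _ =>
    hU.preimage ((continuous_evalChar_mul t).comp (continuous_evalChar_mul s))
  have hμV : μ ∈ V := mem_iInter₂.2 fun s _ => by
    simpa using hE (mem_univ (evalChar F s))
  obtain ⟨x, hx⟩ := denseRange_evalChar.exists_mem_open hV ⟨μ, hμV⟩
  refine ⟨x, mem_iInter₂.2 fun s hs => ?_⟩
  obtain ⟨t, ht, hts⟩ := mem_iUnion₂.1 (mem_iInter₂.1 hx s hs)
  refine mem_iUnion₂.2 ⟨t, ht, hUA _ ?_⟩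
  rw [evalChar_mul, evalChar_mul]
  exact hts

lemma exists_mem_closure_of_isPiecewiseSyndetic {A : Set S} (hA : IsPiecewiseSyndetic A) :
    ∃ μ ∈ smallestIdeal F.Spectrum, μ ∈ closure (evalChar F '' A) := by
  classical
  obtain ⟨E, hE⟩ := hA
  let B : Set S := ⋃ t ∈ E, leftQuotient t A
  obtain ⟨U, hU⟩ : ∃ U : Ultrafilter S, ∀ s, leftQuotient s B ∈ U := by
    have : (⨅ s : S, 𝓟 (leftQuotient s B)).NeBot := by
      rw [(hasBasis_iInf_principal_finite _).neBot_iff]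
      intro G hG
      simpa using hE hG.toFinset
    exact ⟨Ultrafilter.of _, fun s => Ultrafilter.of_le _
      (mem_iInf_of_mem s (mem_principal_self _))⟩
  obtain ⟨μ, -, hμ⟩ := isCompact_univ.ultrafilter_le_nhds (U.map (evalChar F)) (by simp)
  have hμ' : Tendsto (evalChar F) U (𝓝 μ) := hμ
  -- Finiteness of `E` makes `C` closed, so membership passes to limits: from `S` to `μ`, then from
  -- evaluations to all `ν`.
  let C : Set F.Spectrum := ⋃ t ∈ E, {ν | evalChar F t * ν ∈ closure (evalChar F '' A)}
  have hC : IsClosed C := E.finite_toSet.isClosed_biUnion fun t _ =>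
    isClosed_closure.preimage (continuous_evalChar_mul t)
  have hs : ∀ s, evalChar F s * μ ∈ C := fun s => by
    refine hC.mem_of_tendsto (((continuous_evalChar_mul s).tendsto μ).comp hμ') ?_
    filter_upwards [hU s] with x hx
    obtain ⟨t, ht, htx⟩ := mem_iUnion₂.1 hx
    refine mem_iUnion₂.2 ⟨t, ht, subset_closure ⟨t * (s * x), htx, ?_⟩⟩
    simp only [Function.comp, evalChar_mul]
  have hall : ∀ ν : F.Spectrum, ν * μ ∈ C := fun ν =>
    denseRange_evalChar.induction_on ν
      (hC.preimage (continuous_spectrum_mul_right μ)) hs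
  obtain ⟨κ, hκ⟩ := smallestIdeal_nonempty (X := F.Spectrum) continuous_spectrum_mul_right
  obtain ⟨t, -, ht⟩ := mem_iUnion₂.1 (hall κ)
  -- The witness is `evalChar F t * (κ * μ)`.
  exact ⟨_, mul_left_mem_smallestIdeal _ (mul_right_mem_smallestIdeal hκ μ), ht⟩

end MAdmissible

end SemigroupCompactification

end

open SemigroupCompactification MAdmissible in
theorem mainTheorem2 {S : Type*} [Semigroup S] [Nonempty S] [TopologicalSpace S] [T2Space S]
    [SeparatelyContinuousMul S] (F : SemigroupCompactification.MAdmissible S) (A : Set S) :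
    (((SemigroupCompactification.MAdmissible.hat A : Set F.Delta) ∩
          SemigroupCompactification.smallestIdeal F.Delta).Nonempty →
        SemigroupCompactification.IsPiecewiseSyndetic A) ∧
      (IsOpen[F.tau] A → SemigroupCompactification.IsPiecewiseSyndetic A →
        (closure (SemigroupCompactification.MAdmissible.hat A : Set F.Delta) ∩
          SemigroupCompactification.smallestIdeal F.Delta).Nonempty) := by
  constructor
  · rintro ⟨p, hpA, hpK⟩
    obtain ⟨μ, rfl⟩ := toDelta_surjective p
    exact isPiecewiseSyndetic_of_mem_hat hpA (mem_smallestIdeal_of_toDelta hpK)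
  · intro hopen hA
    obtain ⟨μ, hμ, hcl⟩ := exists_mem_closure_of_isPiecewiseSyndetic (F := F) hA
    refine ⟨toDelta μ, map_mem_closure continuous_toDelta hcl ?_, toDelta_mem_smallestIdeal hμ⟩
    rintro _ ⟨a, ha, rfl⟩
    exact toDelta_evalChar_mem_hat hopen ha
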